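/- For a finite group $G$ write $d(G)$ for the minimum number of elements needed to generate $G$, and for a finite abelian group $A$ write $d_3(A)$ for the minimum number of generators of the Sylow $3$-subgroup of $A$. Let $A$ be a finite abelian group and let $W = A \wr A_4$ be the wreath product of $A$ by the alternating group $A_4$ with respect to the natural action of $A_4$ on $4$ points, that is, the semidirect product $A^4 \rtimes A_4$ in which $A_4$ permutes the four coordinates. Then \[ d(W) = \max\bigl(2,\ d(A),\ d_3(A)+1\bigr). \] -/

import Mathlib

/-- The permutational wreath product `G ≀_Y H`: the semidirect product `(∏_{y ∈ Y} G) ⋊ H`, where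
`H` permutes the coordinates as it acts on `Y`, that is `(h • f) y = f (h⁻¹ • y)`. -/
abbrev PermWreath (G H Y : Type*) [Group G] [Group H] [MulAction H Y] : Type _ :=
  SemidirectProduct (Y → G) H (mulAutArrow : H →* MulAut (Y → G))

/-- The wreath product of finite groups over a finite set is finite. -/
instance PermWreath.instFinite (G H Y : Type*) [Group G] [Group H] [MulAction H Y]
    [Finite G] [Finite H] [Finite Y] : Finite (PermWreath G H Y) :=
  Finite.of_equiv ((Y → G) × H) (SemidirectProduct.equivProd).symm

/-!
Write `W` for the wreath product `A ≀ A₄`.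

*Lower bounds.* The quotient `A₄` of `W` is not commutative, so `W` is not generated by one element.
Multiplying the four coordinates maps `W` onto `A`. Since `A₄` has a quotient of order `3` and `P` is
a quotient of `A`, the group `W` also maps onto `P × C₃`, and the product of a finite commutative
`p`-group `P` with a group of order `p` needs one generator more than `P`
(`rank_succ_le_rank_prod_of_card_eq_prime`): an exchange step makes all generators but one
trivial in the second coordinate, and the exceptional one contributes to `P` only a `p`-th power,
which is superfluous in a `p`-group.

*Upper bound.* Let `n ≥ 2` with `d(A) ≤ n` and `d(P) ≤ n - 1`. Multiplying generators of `P` by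
elements of order prime to `3` yields generators `a₀, …, aₙ₋₁` of `A` with the order of `a₀` prime to
`3` (`exists_generators_coprime_orderOf`). Let `σ = (0 1 2)`, `τ = (0 1)(2 3)`, and write `a[i]` for
the element `a` in coordinate `i`. Then `W` is generated by
`a₀[3] σ`, `a₁[3] τ`, `a₂[0]`, …, `aₙ₋₁[0]` (`closure_range_wreathGenerators`). Indeed
`(a₀[3] σ)³ = a₀³[3]`, because `σ` fixes `3`; as the order of `a₀` is prime to `3`, this yields
`a₀[3]` and hence `σ`. Next `(a₁[3] τ)² = a₁[2] a₁[3]` and, since `σ τ` is the `3`-cycle `(0 2 3)`,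
`(σ a₁[3] τ)³ = a₁[0] a₁[2] a₁[3]`; the quotient of the two is `a₁[0]`, and conjugation by
`σ a₁[3] τ`, which moves coordinate `3` to `0`, takes `a₁[3]` to `a₁[0]`, so `a₁[3]` and `τ` are
obtained too. Conjugation under `A₄ = ⟨σ, τ⟩` then moves every `aᵢ` to every coordinate.
-/

/-! ### Generating tuples -/

theorem mem_of_pow_mem_of_coprime {G : Type*} [Group G] {H : Subgroup G} {x : G} {m n : ℕ}
    (hm : x ^ m ∈ H) (hn : x ^ n ∈ H) (h : m.Coprime n) : x ∈ H := by
  have key : x = (x ^ m) ^ (m.gcdA n) * (x ^ n) ^ (m.gcdB n) := by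
    rw [← zpow_natCast, ← zpow_natCast, ← zpow_mul, ← zpow_mul, ← zpow_add,
      ← Nat.gcd_eq_gcd_ab, h.gcd_eq_one, Nat.cast_one, zpow_one]
  rw [key]
  exact H.mul_mem (H.zpow_mem hm _) (H.zpow_mem hn _)

theorem exists_closure_range_eq_top_of_rank_le {G : Type*} [Group G] [Group.FG G] {n : ℕ}
    (h : Group.rank G ≤ n) : ∃ f : Fin n → G, Subgroup.closure (Set.range f) = ⊤ := by
  obtain ⟨S, hcard, hS⟩ := Group.rank_spec G
  refine ⟨fun i ↦ if hi : i.val < S.card then (S.equivFin.symm ⟨i, hi⟩ : G) else 1, ?_⟩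
  rw [eq_top_iff, ← hS]
  refine Subgroup.closure_mono fun x hx ↦ ?_
  refine ⟨⟨S.equivFin ⟨x, hx⟩, (S.equivFin ⟨x, hx⟩).isLt.trans_le (hcard.trans_le h)⟩, ?_⟩
  simp

theorem rank_le_of_closure_range_eq_top {G : Type*} [Group G] [Group.FG G] {n : ℕ} (f : Fin n → G)
    (h : Subgroup.closure (Set.range f) = ⊤) : Group.rank G ≤ n := by
  classical
  refine (Group.rank_le (S := Finset.univ.image f) (by simpa using h)).trans ?_
  simpa using Finset.card_image_le (s := Finset.univ) (f := f)

theorem two_le_rank_of_mul_ne_mul {G : Type*} [Group G] [Group.FG G] {x y : G}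
    (h : x * y ≠ y * x) : 2 ≤ Group.rank G := by
  by_contra! hlt
  obtain ⟨f, hf⟩ := exists_closure_range_eq_top_of_rank_le (Nat.le_of_lt_succ hlt)
  have hmem : ∀ z : G, z ∈ Subgroup.zpowers (f 0) := by
    intro z
    have hr : Set.range f = {f 0} := by
      ext
      simp [eq_comm]
    rw [Subgroup.zpowers_eq_closure, ← hr, hf]
    exact Subgroup.mem_top z
  obtain ⟨a, rfl⟩ := hmem x
  obtain ⟨b, rfl⟩ := hmem y
  exact h (zpow_mul_comm _ _ _)

/-! ### Generators of finite commutative groups and their Sylow subgroups -/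

/-- Nakayama's lemma for finite commutative `p`-groups, with `P ^ p` in the role of the Frattini
subgroup: a subgroup that meets every coset of the `p`-th powers is the whole group. -/
theorem eq_top_of_forall_exists_mul_pow {p : ℕ} [hp : Fact p.Prime] {P : Type*} [CommGroup P]
    [Finite P] (hP : IsPGroup p P) {N : Subgroup P} (h : ∀ x : P, ∃ n ∈ N, ∃ y, x = n * y ^ p) :
    N = ⊤ := by
  have hsurj : Function.Surjective (fun q : P ⧸ N ↦ q ^ p) := by
    intro q
    obtain ⟨x, rfl⟩ := QuotientGroup.mk_surjective q
    obtain ⟨n, hn, y, rfl⟩ := h x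
    refine ⟨(y : P ⧸ N), ?_⟩
    simp [(QuotientGroup.eq_one_iff n).2 hn]
  have hinj := Finite.injective_iff_surjective.2 hsurj
  rw [← QuotientGroup.subsingleton_iff]
  by_contra hns
  rw [not_subsingleton_iff_nontrivial] at hns
  obtain ⟨k, hk, hcard⟩ := (hP.to_quotient N).nontrivial_iff_card.1 hns
  obtain ⟨q, hq⟩ := exists_prime_orderOf_dvd_card' (G := P ⧸ N) p
    (hcard ▸ dvd_pow_self p hk.ne')
  have h1 : q = 1 := hinj (by simp [← hq, pow_orderOf_eq_one])
  rw [h1, orderOf_one] at hq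
  exact hp.out.one_lt.ne hq

theorem rank_succ_le_rank_prod_of_card_eq_prime {p : ℕ} [hp : Fact p.Prime] {P C : Type*}
    [CommGroup P] [Finite P] [CommGroup C] [Finite C] (hP : IsPGroup p P) (hC : Nat.card C = p) :
    Group.rank P + 1 ≤ Group.rank (P × C) := by
  classical
  obtain ⟨S, hcard, hS⟩ := Group.rank_spec (P × C)
  have : Nontrivial C := by
    rw [← Finite.one_lt_card_iff_nontrivial, hC]
    exact hp.out.one_lt
  obtain ⟨s, hs, hs1⟩ : ∃ s ∈ S, s.2 ≠ 1 := by
    by_contra! hall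
    have hle : Subgroup.closure (S : Set (P × C)) ≤ (MonoidHom.snd P C).ker :=
      (Subgroup.closure_le _).2 fun x hx ↦ hall x hx
    obtain ⟨c, hc⟩ := exists_ne (1 : C)
    have hmem : ((1, c) : P × C) ∈ (MonoidHom.snd P C).ker := hle (hS ▸ Subgroup.mem_top _)
    exact hc hmem
  have hzp : ∀ c : C, ∃ k : ℤ, s.2 ^ k = c := fun c ↦
    Subgroup.mem_zpowers_iff.1 (mem_zpowers_of_prime_card hC hs1)
  have hord : orderOf s.2 = p := by
    rw [← hC]
    exact orderOf_eq_card_of_forall_mem_zpowers fun c ↦ mem_zpowers_of_prime_card hC hs1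
  choose k hk using hzp
  -- The first coordinates of the generators, after powers of `s` have cleared the second ones.
  set T : Finset P := (S.erase s).image fun x ↦ x.1 * (s.1 ^ k x.2)⁻¹
  set N := Subgroup.closure (T : Set P)
  have htop : N.prod (⊥ : Subgroup C) ⊔ Subgroup.zpowers s = ⊤ := by
    rw [eq_top_iff, ← hS, Subgroup.closure_le]
    intro x hx
    by_cases hxs : x = s
    · rw [hxs]
      exact Subgroup.mem_sup_right (Subgroup.mem_zpowers s)
    have hx' : x = (x.1 * (s.1 ^ k x.2)⁻¹, 1) * s ^ k x.2 := by
      ext <;> simp [hk]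
    rw [hx']
    refine Subgroup.mul_mem_sup ⟨Subgroup.subset_closure ?_, rfl⟩ (Subgroup.zpow_mem_zpowers s _)
    exact Finset.mem_coe.2 (Finset.mem_image_of_mem _ (Finset.mem_erase.2 ⟨hxs, hx⟩))
  have hN : N = ⊤ := by
    refine eq_top_of_forall_exists_mul_pow hP fun x ↦ ?_
    have hmem : ((x, 1) : P × C) ∈ N.prod (⊥ : Subgroup C) ⊔ Subgroup.zpowers s :=
      htop ▸ Subgroup.mem_top _
    obtain ⟨⟨n, c⟩, ⟨hn, hc⟩, _, ⟨m, rfl⟩, heq⟩ := Subgroup.mem_sup.1 hmem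
    have hc1 : c = 1 := hc
    have h1 : n * s.1 ^ m = x := congrArg Prod.fst heq
    have h2 : s.2 ^ m = 1 := by simpa [hc1] using congrArg Prod.snd heq
    obtain ⟨r, rfl⟩ : (p : ℤ) ∣ m := hord ▸ orderOf_dvd_iff_zpow_eq_one.2 h2
    refine ⟨n, hn, s.1 ^ r, ?_⟩
    rw [← h1, ← zpow_natCast, ← zpow_mul, mul_comm r]
  have hT : T.card + 1 ≤ S.card :=
    (Nat.succ_le_succ Finset.card_image_le).trans_eq (Finset.card_erase_add_one hs)
  rw [← hcard]
  exact (Nat.succ_le_succ (Group.rank_le hN)).trans hT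

/-- Raising to the power of the index of `P` maps the whole group into `P`, and this power map is a
bijection on `P`. -/
theorem exists_surjective_hom_sylow {A : Type*} [CommGroup A] [Finite A] {p : ℕ} [Fact p.Prime]
    (P : Sylow p A) : ∃ f : A →* P, Function.Surjective f := by
  refine ⟨(powMonoidHom (P : Subgroup A).index).codRestrict (P : Subgroup A)
    fun x ↦ Subgroup.pow_index_mem _ x, fun y ↦ ?_⟩
  obtain ⟨x, hx⟩ := (powCoprime P.card_coprime_index).surjective y
  exact ⟨x, Subtype.ext (congrArg Subtype.val hx)⟩

/-- If a Sylow `p`-subgroup needs fewer than `n` generators, then `n` generators of a finite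
commutative group can be chosen so that the first one has order prime to `p`: the `p`-part is left
to the others. -/
theorem exists_generators_coprime_orderOf {A : Type*} [CommGroup A] [Finite A] {p : ℕ}
    [hp : Fact p.Prime] (P : Sylow p A) {n : ℕ} (hA : Group.rank A ≤ n + 1)
    (hP : Group.rank P ≤ n) :
    ∃ h : Fin (n + 1) → A, Subgroup.closure (Set.range h) = ⊤ ∧ (orderOf (h 0)).Coprime p := by
  obtain ⟨f, hf⟩ := exists_closure_range_eq_top_of_rank_le hA
  obtain ⟨g, hg⟩ := exists_closure_range_eq_top_of_rank_le hP
  set c := Nat.card P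
  set r := (P : Subgroup A).index
  have hcr : c.Coprime r := P.card_coprime_index
  have hpow : ∀ x : A, (x ^ c) ^ r = 1 := fun x ↦ by
    rw [← pow_mul, (P : Subgroup A).card_mul_index, pow_card_eq_one']
  refine ⟨Fin.cons (f 0 ^ c) fun i ↦ g i * f i.succ ^ c, ?_, ?_⟩
  · set H := Subgroup.closure
      (Set.range (Fin.cons (f 0 ^ c) fun i ↦ (g i : A) * f i.succ ^ c : Fin (n + 1) → A))
    have h0 : f 0 ^ c ∈ H := Subgroup.subset_closure ⟨0, rfl⟩
    have hsucc : ∀ i : Fin n, (g i : A) * f i.succ ^ c ∈ H := fun i ↦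
      Subgroup.subset_closure ⟨i.succ, by simp⟩
    have hfs : ∀ i : Fin n, f i.succ ^ c ∈ H := fun i ↦ by
      refine mem_of_pow_mem_of_coprime (m := c) ?_ ((hpow _).symm ▸ H.one_mem) hcr
      have hgc : (g i : A) ^ c = 1 := by
        rw [← Subgroup.coe_pow, pow_card_eq_one', Subgroup.coe_one]
      have := H.pow_mem (hsucc i) c
      rwa [mul_pow, hgc, one_mul] at this
    have hPH : (P : Subgroup A) ≤ H := by
      have hcl : (Subgroup.closure (Set.range g)).map (P : Subgroup A).subtype ≤ H := by
        rw [Subgroup.map_le_iff_le_comap, Subgroup.closure_le]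
        rintro _ ⟨i, rfl⟩
        exact (H.mul_mem_cancel_right (hfs i)).1 (hsucc i)
      rw [hg] at hcl
      exact fun x hx ↦ hcl ⟨⟨x, hx⟩, Subgroup.mem_top _, rfl⟩
    rw [eq_top_iff, ← hf, Subgroup.closure_le]
    rintro _ ⟨i, rfl⟩
    refine mem_of_pow_mem_of_coprime (m := c) ?_ (hPH (Subgroup.pow_index_mem _ (f i))) hcr
    exact Fin.cases h0 hfs i
  · have hrp : r.Coprime p := ((Nat.Prime.coprime_iff_not_dvd hp.out).2 P.not_dvd_index).symm
    exact Nat.Coprime.of_dvd_left (orderOf_dvd_of_pow_eq_one (hpow (f 0))) hrp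

/-! ### Quotients of the wreath product -/

/-- The homomorphism from a wreath product with commutative base to the base that multiplies all
coordinates; it is trivial on the permuting group. -/
def PermWreath.prodHom (A H Y : Type*) [CommGroup A] [Group H] [MulAction H Y] [Fintype Y] :
    PermWreath A H Y →* A where
  toFun w := ∏ y, w.left y
  map_one' := by simp
  map_mul' v w := by
    simp only [SemidirectProduct.mul_left, Pi.mul_apply, Finset.prod_mul_distrib]
    congr 1
    exact Equiv.prod_comp (MulAction.toPerm v.right⁻¹) w.left

/-- Labels of the three ways of splitting `{0, 1, 2, 3}` into two pairs: `pairLabel i j` is the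
label of the splitting that has `{i, j}` as a part. The values at `i = j` play no role. -/
def pairLabel (i j : Fin 4) : ZMod 3 :=
  if i.val ^^^ j.val = 1 then 0 else if i.val ^^^ j.val = 2 then 1 else 2

set_option maxRecDepth 100000 in
/-- The quotient of `A₄` of order `3`: even permutations act on the three splittings of
`{0, 1, 2, 3}` into two pairs as rotations, and a rotation is known from the image of the splitting
labelled `0`. -/
def alternatingFourToZMod : alternatingGroup (Fin 4) →* Multiplicative (ZMod 3) where
  toFun g := .ofAdd (pairLabel (g.1 0) (g.1 1))
  map_one' := by decide
  map_mul' := by decide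

set_option maxRecDepth 100000 in
theorem alternatingFourToZMod_surjective : Function.Surjective alternatingFourToZMod := by
  unfold Function.Surjective
  decide

/-! ### Generators of the wreath product -/

theorem PermWreath.inr_mul_inl_mulSingle {G H Y : Type*} [Group G] [Group H] [MulAction H Y]
    [DecidableEq Y] (h : H) (y : Y) (g : G) :
    (.inr h * .inl (Pi.mulSingle y g) : PermWreath G H Y) =
      .inl (Pi.mulSingle (h • y) g) * .inr h := by
  have hs : (mulAutArrow h : MulAut (Y → G)) (Pi.mulSingle y g) = Pi.mulSingle (h • y) g := by
    ext z
    change (Pi.mulSingle y g : Y → G) (h⁻¹ • z) = _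
    simp only [Pi.mulSingle_apply, inv_smul_eq_iff]
  rw [← hs, SemidirectProduct.inl_aut, map_inv, inv_mul_cancel_right]

/-- A subgroup of a wreath product that contains the permuting group, transitive on the coordinates,
and each of a set of generators of the base group in some coordinate, is everything. -/
theorem PermWreath.eq_top_of_inr_mem {G H Y ι : Type*} [Group G] [Group H] [MulAction H Y]
    [MulAction.IsPretransitive H Y] [Finite Y] [DecidableEq Y] {K : Subgroup (PermWreath G H Y)}
    (hH : ∀ h : H, .inr h ∈ K) {a : ι → G} (ha : Subgroup.closure (Set.range a) = ⊤)
    (hG : ∀ i, ∃ y, .inl (Pi.mulSingle y (a i)) ∈ K) : K = ⊤ := by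
  have hmove : ∀ (g : G) (y z : Y), .inl (Pi.mulSingle y g) ∈ K → .inl (Pi.mulSingle z g) ∈ K := by
    intro g y z hy
    obtain ⟨h, rfl⟩ := MulAction.exists_smul_eq H y z
    rw [← K.mul_mem_cancel_right (hH h), ← PermWreath.inr_mul_inl_mulSingle]
    exact K.mul_mem (hH h) hy
  have hsingle : ∀ (y : Y) (g : G), .inl (Pi.mulSingle y g) ∈ K := by
    intro y g
    have hle : Subgroup.closure (Set.range a) ≤
        K.comap (SemidirectProduct.inl.comp (MonoidHom.mulSingle (fun _ : Y ↦ G) y)) := by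
      rw [Subgroup.closure_le]
      rintro _ ⟨i, rfl⟩
      obtain ⟨z, hz⟩ := hG i
      exact hmove _ z y hz
    exact hle (ha ▸ Subgroup.mem_top g)
  rw [eq_top_iff]
  intro w _
  rw [← SemidirectProduct.inl_left_mul_inr_right w]
  refine K.mul_mem ?_ (hH _)
  have hpi : w.left ∈ K.comap SemidirectProduct.inl :=
    Subgroup.pi_mem_of_mulSingle_mem _ fun y ↦ hsingle y _
  exact hpi

/-- The `3`-cycle `(0 1 2)`. -/
def sigmaFour : alternatingGroup (Fin 4) := ⟨c[0, 1, 2], Equiv.Perm.mem_alternatingGroup.2 (by decide)⟩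

/-- The double transposition `(0 1)(2 3)`. -/
def tauFour : alternatingGroup (Fin 4) := ⟨c[0, 1] * c[2, 3], Equiv.Perm.mem_alternatingGroup.2 (by decide)⟩

set_option maxRecDepth 100000 in
theorem exists_eq_sigmaFour_pow_mul_tauFour_pow (g : alternatingGroup (Fin 4)) :
    ∃ (i : Fin 3) (e : Fin 2) (j : Fin 3),
      g = sigmaFour ^ i.val * tauFour ^ e.val * sigmaFour ^ j.val := by
  revert g
  decide

set_option maxRecDepth 100000 in
theorem alternatingFour_isPretransitive :
    MulAction.IsPretransitive (alternatingGroup (Fin 4)) (Fin 4) :=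
  ⟨by decide⟩

section WreathIdentities

variable {A : Type*} [CommGroup A]

local notation "W" => PermWreath A (alternatingGroup (Fin 4)) (Fin 4)

theorem inl_mulSingle_mul_inr_sigmaFour_pow_three (a : A) :
    (.inl (Pi.mulSingle 3 a) * .inr sigmaFour : W) ^ 3 = .inl (Pi.mulSingle 3 a) ^ 3 := by
  have hfix : sigmaFour • (3 : Fin 4) = 3 := by decide
  have hcomm : Commute (.inl (Pi.mulSingle 3 a) : W) (.inr sigmaFour) := by
    have := PermWreath.inr_mul_inl_mulSingle sigmaFour (3 : Fin 4) a
    rw [hfix] at this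
    exact this.symm
  have h3 : sigmaFour ^ 3 = 1 := by decide
  rw [hcomm.mul_pow, ← map_pow SemidirectProduct.inr, h3, map_one, mul_one]

theorem inl_mulSingle_mul_inr_tauFour_sq (a : A) :
    (.inl (Pi.mulSingle 3 a) * .inr tauFour : W) ^ 2 =
      .inl (Pi.mulSingle 3 a * Pi.mulSingle 2 a) := by
  have h2 : tauFour * tauFour = 1 := by decide
  have h32 : tauFour • (3 : Fin 4) = 2 := by decide
  calc (.inl (Pi.mulSingle 3 a) * .inr tauFour : W) ^ 2
      = .inl (Pi.mulSingle 3 a) * (.inr tauFour * .inl (Pi.mulSingle 3 a)) * .inr tauFour := by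
        simp only [pow_succ, pow_zero, one_mul, mul_assoc]
    _ = .inl (Pi.mulSingle 3 a) * .inl (Pi.mulSingle 2 a) * .inr (tauFour * tauFour) := by
        rw [PermWreath.inr_mul_inl_mulSingle, h32, map_mul]
        simp only [mul_assoc]
    _ = _ := by rw [h2, map_one, mul_one, map_mul]

theorem inr_sigmaFour_mul (a : A) :
    (.inr sigmaFour * (.inl (Pi.mulSingle 3 a) * .inr tauFour) : W) =
      .inl (Pi.mulSingle 3 a) * .inr (sigmaFour * tauFour) := by
  have hs : sigmaFour • (3 : Fin 4) = 3 := by decide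
  rw [← mul_assoc, PermWreath.inr_mul_inl_mulSingle, hs, mul_assoc, ← map_mul]

theorem inr_sigmaFour_mul_mul_inl_mulSingle (a b : A) :
    (.inr sigmaFour * (.inl (Pi.mulSingle 3 a) * .inr tauFour) : W) * .inl (Pi.mulSingle 3 b) =
      .inl (Pi.mulSingle 0 b) * (.inr sigmaFour * (.inl (Pi.mulSingle 3 a) * .inr tauFour)) := by
  have h30 : (sigmaFour * tauFour) • (3 : Fin 4) = 0 := by decide
  rw [inr_sigmaFour_mul, mul_assoc, PermWreath.inr_mul_inl_mulSingle, h30, ← mul_assoc,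
    ← mul_assoc, ← map_mul, ← map_mul, mul_comm]

theorem inr_sigmaFour_mul_pow_three (a : A) :
    (.inr sigmaFour * (.inl (Pi.mulSingle 3 a) * .inr tauFour) : W) ^ 3 =
      .inl (Pi.mulSingle 0 a) * .inl (Pi.mulSingle 3 a * Pi.mulSingle 2 a) := by
  obtain ⟨ρ, hρ⟩ : ∃ ρ, ρ = sigmaFour * tauFour := ⟨_, rfl⟩
  have h3 : ρ * ρ * ρ = 1 := by rw [hρ]; decide
  have h30 : ρ • (3 : Fin 4) = 0 := by rw [hρ]; decide
  have h02 : ρ • (0 : Fin 4) = 2 := by rw [hρ]; decide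
  have hstep := hρ ▸ inr_sigmaFour_mul a
  calc (.inr sigmaFour * (.inl (Pi.mulSingle 3 a) * .inr tauFour) : W) ^ 3
      = .inl (Pi.mulSingle 3 a) * (.inr ρ * .inl (Pi.mulSingle 3 a)) *
          (.inr ρ * .inl (Pi.mulSingle 3 a)) * .inr ρ := by
        rw [hstep]
        simp only [pow_succ, pow_zero, one_mul, mul_assoc]
    _ = .inl (Pi.mulSingle 3 a) * .inl (Pi.mulSingle 0 a) *
          (.inr ρ * .inl (Pi.mulSingle 0 a)) * .inr ρ * .inr ρ := by
        rw [PermWreath.inr_mul_inl_mulSingle, h30]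
        simp only [mul_assoc]
    _ = .inl (Pi.mulSingle 3 a) * .inl (Pi.mulSingle 0 a) * .inl (Pi.mulSingle 2 a) *
          .inr (ρ * ρ * ρ) := by
        rw [PermWreath.inr_mul_inl_mulSingle, h02, map_mul, map_mul]
        simp only [mul_assoc]
    _ = _ := by
        rw [h3, map_one, mul_one, ← map_mul, ← map_mul, ← map_mul]
        congr 1
        ac_rfl

/-- From generators `a 0, a 1, …` of `A`, the elements `(a 0)[3] σ`, `(a 1)[3] τ` and `(a i)[0]` for
`i ≥ 2` of the wreath product, where `x[i]` is `x` in coordinate `i`. -/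
def wreathGenerators {n : ℕ} (a : Fin (n + 2) → A) : Fin (n + 2) → W :=
  Fin.cons (.inl (Pi.mulSingle 3 (a 0)) * .inr sigmaFour)
    (Fin.cons (.inl (Pi.mulSingle 3 (a 1)) * .inr tauFour)
      fun i ↦ .inl (Pi.mulSingle 0 (a i.succ.succ)))

theorem closure_range_wreathGenerators {n : ℕ} {a : Fin (n + 2) → A}
    (ha : Subgroup.closure (Set.range a) = ⊤) (h0 : (orderOf (a 0)).Coprime 3) :
    Subgroup.closure (Set.range (wreathGenerators a)) = ⊤ := by
  set K := Subgroup.closure (Set.range (wreathGenerators a))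
  have hK : ∀ i, wreathGenerators a i ∈ K := fun i ↦ Subgroup.subset_closure ⟨i, rfl⟩
  have hK0 : (.inl (Pi.mulSingle 3 (a 0)) * .inr sigmaFour : W) ∈ K := hK 0
  have hK1 : (.inl (Pi.mulSingle 3 (a 1)) * .inr tauFour : W) ∈ K := hK 1
  have hK2 : ∀ i : Fin n, (.inl (Pi.mulSingle 0 (a i.succ.succ)) : W) ∈ K := fun i ↦
    hK i.succ.succ
  have ha0 : (.inl (Pi.mulSingle 3 (a 0)) : W) ∈ K := by
    refine mem_of_pow_mem_of_coprime (m := orderOf (a 0)) (n := 3) ?_ ?_ h0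
    · rw [← map_pow, ← Pi.mulSingle_pow, pow_orderOf_eq_one, Pi.mulSingle_one, map_one]
      exact K.one_mem
    · rw [← inl_mulSingle_mul_inr_sigmaFour_pow_three]
      exact K.pow_mem hK0 3
  have hσ : (.inr sigmaFour : W) ∈ K := (K.mul_mem_cancel_left ha0).1 hK0
  have hsq := K.pow_mem hK1 2
  rw [inl_mulSingle_mul_inr_tauFour_sq] at hsq
  have ha1 : (.inl (Pi.mulSingle 0 (a 1)) : W) ∈ K := by
    have hcube := K.pow_mem (K.mul_mem hσ hK1) 3
    rw [inr_sigmaFour_mul_pow_three] at hcube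
    exact (K.mul_mem_cancel_right hsq).1 hcube
  have ha1' : (.inl (Pi.mulSingle 3 (a 1)) : W) ∈ K := by
    have hv := K.mul_mem hσ hK1
    rw [← K.mul_mem_cancel_left hv, inr_sigmaFour_mul_mul_inl_mulSingle]
    exact K.mul_mem ha1 hv
  have hτ : (.inr tauFour : W) ∈ K := (K.mul_mem_cancel_left ha1').1 hK1
  have hH : ∀ g, (.inr g : W) ∈ K := by
    intro g
    obtain ⟨i, e, j, rfl⟩ := exists_eq_sigmaFour_pow_mul_tauFour_pow g
    simp only [map_mul, map_pow]
    exact K.mul_mem (K.mul_mem (K.pow_mem hσ _) (K.pow_mem hτ _)) (K.pow_mem hσ _)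
  have := alternatingFour_isPretransitive
  refine PermWreath.eq_top_of_inr_mem hH ha fun i ↦ ?_
  refine Fin.cases ⟨3, ha0⟩ (fun i ↦ ?_) i
  exact Fin.cases ⟨0, ha1⟩ (fun i ↦ ⟨0, hK2 i⟩) i

end WreathIdentities

/-! ### The rank of the wreath product -/

theorem mainTheorem3 {A : Type*} [CommGroup A] [Finite A] (P : Sylow 3 A) :
    Group.rank (PermWreath A (alternatingGroup (Fin 4)) (Fin 4)) =
      max 2 (max (Group.rank A) (Group.rank P + 1)) := by
  set W := PermWreath A (alternatingGroup (Fin 4)) (Fin 4)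
  have hprod : ∀ (a : A) (g : alternatingGroup (Fin 4)),
      PermWreath.prodHom A _ _ (.inl (Pi.mulSingle 0 a) * .inr g : W) = a := fun a g ↦ by
    change ∏ y, (.inl (Pi.mulSingle 0 a) * .inr g : W).left y = a
    rw [SemidirectProduct.mul_left]
    simp
  refine le_antisymm ?_ (max_le ?_ (max_le ?_ ?_))
  · obtain ⟨n, hn⟩ := Nat.exists_eq_add_of_le'
      (le_max_left 2 (max (Group.rank A) (Group.rank P + 1)))
    have hle := le_max_right 2 (max (Group.rank A) (Group.rank P + 1))
    rw [hn, max_le_iff] at hle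
    rw [hn]
    obtain ⟨a, ha, h0⟩ := exists_generators_coprime_orderOf P hle.1 (Nat.le_of_succ_le_succ hle.2)
    exact rank_le_of_closure_range_eq_top _ (closure_range_wreathGenerators ha h0)
  · have hne : sigmaFour * tauFour ≠ tauFour * sigmaFour := by decide
    exact (two_le_rank_of_mul_ne_mul hne).trans
      (Group.rank_le_of_surjective (SemidirectProduct.rightHom : W →* _)
        SemidirectProduct.rightHom_surjective)
  · exact Group.rank_le_of_surjective (PermWreath.prodHom A _ _ : W →* A) fun a ↦ ⟨_, hprod a 1⟩
  · obtain ⟨f, hf⟩ := exists_surjective_hom_sylow P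
    refine (rank_succ_le_rank_prod_of_card_eq_prime (C := Multiplicative (ZMod 3)) P.isPGroup'
      (by simp)).trans ?_
    refine Group.rank_le_of_surjective ((f.comp (PermWreath.prodHom A _ _)).prod
      (alternatingFourToZMod.comp SemidirectProduct.rightHom) : W →* _) ?_
    rintro ⟨x, c⟩
    obtain ⟨a, rfl⟩ := hf x
    obtain ⟨g, rfl⟩ := alternatingFourToZMod_surjective c
    exact ⟨.inl (Pi.mulSingle 0 a) * .inr g, by simp [hprod]⟩
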